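/- Let $S$ and $T$ be first-order theories, possibly in different signatures. For a theory $U$, let $\mathrm{Mod}(U)$ be the category of models of $U$, with embeddings as morphisms. A theory $U^*$ (a deductively closed set of sentences) in the signature of $U$ is a \emph{model-companion} of $U$ if every model of either of $U$, $U^*$ embeds in a model of the other, and $U^*$ is model-complete, that is, for every model $M$ of $U^*$, the union of $U^*$ and the diagram of $M$ (the quantifier-free theory of $M$ with parameters) axiomatizes a complete theory. Let $I$ be a parameter-free interpretation that takes each model $A$ of $S$ to a model $I(A)$ of $T$ (the quotient of a definable set of $n$-tuples from $A$, for some fixed $n\geq 1$, by a definable equivalence relation, the structure being defined by formulas), and let $J$ be an interpretation that likewise takes each model $B$ of $T$ to a model $J(B)$ of $S$. Suppose $(I,J)$ is a bi-interpretation: there is a formula defining, in each model $A$ of $S$, an isomorphism from $J(I(A))$ to $A$, and there is a formula defining, in each model $B$ of $T$, an isomorphism from $I(J(B))$ to $B$. Suppose further that $I$ is an equivalence of the categories $\mathrm{Mod}(S)$ and $\mathrm{Mod}(T)$: every embedding of models of $S$ induces, coordinatewise, an embedding of the interpreted models of $T$, and the resulting functor is an equivalence of categories. If $S$ has a model-companion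 $S^*$ with $S\subseteq S^*$, then $T$ also has a model-companion, namely the theory of those models $B$ of $T$ such that $J(B)\models S^*$ (the set of all sentences true in all such $B$). -/

import Mathlib

open FirstOrder CategoryTheory

universe u

namespace Companion

/-! Signatures and (nonempty) models all live in one universe `u`. -/

/-- The nonempty models of a set `T` of sentences. -/
abbrev Mod {L : FirstOrder.Language.{u, u}} (T : L.Theory) : Type (u + 1) :=
  FirstOrder.Language.Theory.ModelType.{u, u, u} T

/-- The category of models of `T`; the morphisms are the embeddings. -/
instance modCategory {L : FirstOrder.Language.{u, u}} (T : L.Theory) : Category.{u, u + 1} (Mod T) where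
  Hom A B := A ↪[L] B
  id A := FirstOrder.Language.Embedding.refl L A
  comp f g := g.comp f

/-! ### Model-companions -/

/-- A theory proper: a set of sentences that is closed under logical implication. -/
def IsDeductivelyClosed {L : FirstOrder.Language.{u, u}} (T : L.Theory) : Prop :=
  ∀ φ : L.Sentence, T ⊨ᵇ φ → φ ∈ T

/-- The diagram of `M`: the quantifier-free sentences with parameters that are true in `M`. -/
def diagram (L : FirstOrder.Language.{u, u}) (M : Type u) [L.Structure M] : L[[M]].Theory :=
  {φ | FirstOrder.Language.BoundedFormula.IsQF φ ∧ M ⊨ φ}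

/-- `T` is model-complete: for all models `M` of `T`, the union of `T` with the diagram of `M`
axiomatizes a complete theory. -/
def IsModelComplete {L : FirstOrder.Language.{u, u}} (T : L.Theory) : Prop :=
  ∀ M : Mod T, ((L.lhomWithConstants M).onTheory T ∪ diagram L M).IsComplete

/-- Every model of `T` embeds in a model of `T'`. -/
def ModelsEmbed {L : FirstOrder.Language.{u, u}} (T T' : L.Theory) : Prop :=
  ∀ M : Mod T, ∃ N : Mod T', Nonempty (M ↪[L] N)

/-- The theory `T'` is a model-companion of (the theory axiomatized by) `T`. -/
structure IsModelCompanion {L : FirstOrder.Language.{u, u}} (T T' : L.Theory) : Prop where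
  closed : IsDeductivelyClosed T'
  embed : ModelsEmbed T T'
  embed_back : ModelsEmbed T' T
  modelComplete : IsModelComplete T'

/-! ### Interpretations -/

/-- The formulas of a (`dim`-dimensional, parameter-free) interpretation of `L₂`-structures in
`L₁`-structures: a formula for the domain, and a formula for each unnested atomic formula
`x = y`, `f x₀ … x₍ₖ₋₁₎ = xₖ`, `R x₀ … x₍ₖ₋₁₎` of `L₂`.  Each variable of `L₂` becomes a
`dim`-tuple of variables of `L₁`. -/
structure Scheme (L₁ L₂ : FirstOrder.Language.{u, u}) where
  dim : ℕ
  dim_pos : 0 < dim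
  dom : L₁.Formula (Fin dim)
  eqv : L₁.Formula (Fin 2 × Fin dim)
  graph : ∀ {k : ℕ}, L₂.Functions k → L₁.Formula (Fin (k + 1) × Fin dim)
  rel : ∀ {k : ℕ}, L₂.Relations k → L₁.Formula (Fin k × Fin dim)

namespace Scheme

variable {L₁ L₂ : FirstOrder.Language.{u, u}} (Γ : Scheme L₁ L₂) (A : Type u) [L₁.Structure A]

/-- The tuples from `A` that satisfy the domain formula. -/
abbrev Dom : Type u := {a : Fin Γ.dim → A // Γ.dom.Realize a}

variable {A}

/-- The formula `φ` is true in `A` of the `k`-tuple `a` of elements of the domain. -/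
def Holds {k : ℕ} (φ : L₁.Formula (Fin k × Fin Γ.dim)) (a : Fin k → Γ.Dom A) : Prop :=
  φ.Realize fun p => (a p.1).1 p.2

/-- The relation on the domain that interprets equality. -/
def Eqv (a b : Γ.Dom A) : Prop := Γ.Holds Γ.eqv ![a, b]

variable (A)

/-- The admissibility conditions: the formulas do define an `L₂`-structure on the quotient of the
domain by the relation that interprets equality. -/
structure Admissible : Prop where
  nonempty : Nonempty (Γ.Dom A)
  equivalence : Equivalence (Γ.Eqv (A := A))
  rel_congr : ∀ {k : ℕ} (R : L₂.Relations k) (a b : Fin k → Γ.Dom A),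
    (∀ i, Γ.Eqv (a i) (b i)) → Γ.Holds (Γ.rel R) a → Γ.Holds (Γ.rel R) b
  graph_congr : ∀ {k : ℕ} (f : L₂.Functions k) (a b : Fin (k + 1) → Γ.Dom A),
    (∀ i, Γ.Eqv (a i) (b i)) → Γ.Holds (Γ.graph f) a → Γ.Holds (Γ.graph f) b
  graph_total : ∀ {k : ℕ} (f : L₂.Functions k) (a : Fin k → Γ.Dom A),
    ∃ b : Γ.Dom A, Γ.Holds (Γ.graph f) (Fin.snoc (α := fun _ => Γ.Dom A) a b)
  graph_unique : ∀ {k : ℕ} (f : L₂.Functions k) (a : Fin k → Γ.Dom A) (b c : Γ.Dom A),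
    Γ.Holds (Γ.graph f) (Fin.snoc (α := fun _ => Γ.Dom A) a b) →
    Γ.Holds (Γ.graph f) (Fin.snoc (α := fun _ => Γ.Dom A) a c) → Γ.Eqv b c

variable {Γ A}

/-- The universe of the interpreted structure. -/
def Carrier (h : Γ.Admissible A) : Type u := Quotient (Setoid.mk Γ.Eqv h.equivalence)

/-- The coordinate map, from the domain onto the interpreted structure. -/
def coord (h : Γ.Admissible A) (a : Γ.Dom A) : Carrier h :=
  Quotient.mk (Setoid.mk Γ.Eqv h.equivalence) a

/-- A representative in the domain of an element of the interpreted structure. -/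
noncomputable def out (h : Γ.Admissible A) (x : Carrier h) : Γ.Dom A := Quotient.out x

/-- The interpreted structure. -/
noncomputable instance structureCarrier (h : Γ.Admissible A) : L₂.Structure (Carrier h) where
  funMap f x := coord h (Classical.choose (h.graph_total f fun i => out h (x i)))
  RelMap R x := Γ.Holds (Γ.rel R) fun i => out h (x i)

theorem coord_out (h : Γ.Admissible A) (x : Carrier h) : coord h (out h x) = x := Quotient.out_eq x

theorem coord_surjective (h : Γ.Admissible A) : Function.Surjective (coord h) :=
  fun x => ⟨out h x, coord_out h x⟩

theorem coord_eq_coord (h : Γ.Admissible A) (a b : Γ.Dom A) : coord h a = coord h b ↔ Γ.Eqv a b :=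
  ⟨fun e => Quotient.exact e, fun e => Quotient.sound e⟩

theorem eqv_out (h : Γ.Admissible A) (a : Γ.Dom A) : Γ.Eqv (out h (coord h a)) a :=
  (coord_eq_coord h _ _).1 (coord_out h _)

instance nonemptyCarrier (h : Γ.Admissible A) : Nonempty (Carrier h) :=
  h.nonempty.map (coord h)

/-- The relations of the interpreted structure are those defined by the formulas. -/
theorem relMap_coord (h : Γ.Admissible A) {k : ℕ} (R : L₂.Relations k) (a : Fin k → Γ.Dom A) :
    FirstOrder.Language.Structure.RelMap R (fun i => coord h (a i)) ↔ Γ.Holds (Γ.rel R) a :=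
  ⟨h.rel_congr R _ _ fun i => eqv_out h (a i),
    h.rel_congr R _ _ fun i => h.equivalence.symm (eqv_out h (a i))⟩

/-- The operations of the interpreted structure are those defined by the formulas. -/
theorem funMap_coord (h : Γ.Admissible A) {k : ℕ} (f : L₂.Functions k) (a : Fin k → Γ.Dom A)
    (b : Γ.Dom A) : FirstOrder.Language.Structure.funMap f (fun i => coord h (a i)) = coord h b ↔
      Γ.Holds (Γ.graph f) (Fin.snoc (α := fun _ => Γ.Dom A) a b) := by
  have key : Γ.Holds (Γ.graph f) (Fin.snoc (α := fun _ => Γ.Dom A) a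
      (Classical.choose (h.graph_total f fun i => out h (coord h (a i))))) := by
    refine h.graph_congr f _ _ (fun i => ?_)
      (Classical.choose_spec (h.graph_total f fun i => out h (coord h (a i))))
    refine Fin.lastCases ?_ (fun j => ?_) i
    · simpa using h.equivalence.refl _
    · simpa using eqv_out h (a j)
  constructor
  · intro e
    refine h.graph_congr f _ _ (fun i => ?_) key
    refine Fin.lastCases ?_ (fun j => ?_) i
    · simpa using (coord_eq_coord h _ _).1 e
    · simpa using h.equivalence.refl _
  · intro e
    exact (coord_eq_coord h _ _).2 (h.graph_unique f a _ _ key e)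

end Scheme

/-- An interpretation taking each model of `S` to a model of `T` (thus an interpretation of `T`
in `S`). -/
structure Interpretation {L₁ L₂ : FirstOrder.Language.{u, u}} (S : L₁.Theory) (T : L₂.Theory)
    extends Scheme L₁ L₂ where
  admissible : ∀ A : Mod S, toScheme.Admissible A
  models : ∀ A : Mod S, Scheme.Carrier (admissible A) ⊨ T

namespace Interpretation

variable {L₁ L₂ : FirstOrder.Language.{u, u}} {S : L₁.Theory} {T : L₂.Theory}

/-- The model of `T` that is interpreted in the model `A` of `S`. -/
noncomputable def obj (I : Interpretation S T) (A : Mod S) : Mod T :=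
  haveI := I.models A
  FirstOrder.Language.Theory.ModelType.of T (Scheme.Carrier (I.admissible A))

/-- The coordinate map. -/
def coord (I : Interpretation S T) {A : Mod S} (a : I.Dom A) : I.obj A :=
  Scheme.coord (I.admissible A) a

theorem coord_surjective (I : Interpretation S T) {A : Mod S} :
    Function.Surjective (I.coord (A := A)) :=
  Scheme.coord_surjective (I.admissible A)

/-- The map `g` from `I(A)` to `I(B)` is induced by the map `h` from `A` to `B`, that is, `h`
takes the domain of `I` in `A` into the domain of `I` in `B`, and `g` takes the element with
coordinates `a` to the element with coordinates `h a`. -/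
def Induces (I : Interpretation S T) {A B : Mod S} (h : A → B) (g : I.obj A → I.obj B) : Prop :=
  ∀ a : I.Dom A, ∃ hb : I.dom.Realize (fun i => h (a.1 i)),
    g (I.coord a) = I.coord ⟨fun i => h (a.1 i), hb⟩

/-- Every embedding of models of `S` induces an embedding of the interpreted models of `T`. -/
def PreservesEmbeddings (I : Interpretation S T) : Prop :=
  ∀ (A B : Mod S) (h : A ↪[L₁] B), ∃ g : I.obj A ↪[L₂] I.obj B, I.Induces h g

theorem Induces.unique {I : Interpretation S T} {A B : Mod S} {h : A → B}
    {g g' : I.obj A ↪[L₂] I.obj B} (hg : I.Induces h g) (hg' : I.Induces h g') : g = g' := by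
  ext x
  obtain ⟨a, rfl⟩ := I.coord_surjective x
  obtain ⟨_, e⟩ := hg a
  obtain ⟨_, e'⟩ := hg' a
  rw [e, e']

/-- The embedding of interpreted structures that is induced by an embedding. -/
noncomputable def map (I : Interpretation S T) (hI : I.PreservesEmbeddings) {A B : Mod S}
    (h : A ↪[L₁] B) : I.obj A ↪[L₂] I.obj B :=
  Classical.choose (hI A B h)

theorem map_induces (I : Interpretation S T) (hI : I.PreservesEmbeddings) {A B : Mod S}
    (h : A ↪[L₁] B) : I.Induces h (I.map hI h) :=
  Classical.choose_spec (hI A B h)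

/-- The functor of an interpretation that preserves embeddings. -/
noncomputable def functor (I : Interpretation S T) (hI : I.PreservesEmbeddings) :
    Mod S ⥤ Mod T where
  obj A := I.obj A
  map h := I.map hI h
  map_id A := (I.map_induces hI (FirstOrder.Language.Embedding.refl L₁ A)).unique
    (g' := FirstOrder.Language.Embedding.refl L₂ (I.obj A)) fun a => ⟨a.2, rfl⟩
  map_comp {A B C} h h' := by
    refine (I.map_induces hI (FirstOrder.Language.Embedding.comp h' h)).unique
      (g' := (I.map hI h').comp (I.map hI h)) fun a => ?_
    obtain ⟨hb, e⟩ := I.map_induces hI h a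
    obtain ⟨hc, e'⟩ := I.map_induces hI h' ⟨_, hb⟩
    exact ⟨hc, (congrArg (I.map hI h') e).trans e'⟩

/-- The interpretation `I` is an equivalence of the categories of models of `S` and `T`. -/
def IsCategoryEquivalence (I : Interpretation S T) : Prop :=
  ∃ hI : I.PreservesEmbeddings, (I.functor hI).IsEquivalence

/-- There is one formula `χ` that defines, in each model `A` of `S`, the graph of an isomorphism
from `J(I(A))` to `A`.  Coordinates in `A` of an element of `J(I(A))` are a tuple of tuples. -/
def DefinablyInverse (I : Interpretation S T) (J : Interpretation T S) : Prop :=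
  ∃ χ : L₁.Formula ((Fin J.dim × Fin I.dim) ⊕ Unit), ∀ A : Mod S,
    ∃ e : J.obj (I.obj A) ≃[L₁] A,
      ∀ (a : Fin J.dim → I.Dom A) (ha : J.dom.Realize fun j => I.coord (a j)) (b : A),
        χ.Realize (Sum.elim (fun p => (a p.1).1 p.2) fun _ => b) ↔
          e (J.coord ⟨fun j => I.coord (a j), ha⟩) = b

/-- `(I, J)` is a bi-interpretation of `S` and `T`. -/
def IsBiInterpretation (I : Interpretation S T) (J : Interpretation T S) : Prop :=
  I.DefinablyInverse J ∧ J.DefinablyInverse I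

/-- The theory of those models `B` of `T` such that `J(B)` is a model of `S'`. -/
def pullbackTheory (J : Interpretation T S) (S' : L₁.Theory) : L₂.Theory :=
  {φ | ∀ B : Mod T, J.obj B ⊨ S' → B ⊨ φ}

end Interpretation

end Companion

/-! Let T* be the theory of those B ⊨ T with J(B) ⊨ S*. Formulas about an interpreted structure
translate back to the interpreting one (`Expressible.formula`), so this class of B is elementary:
its members are exactly the models of T* (`models_pullbackTheory_iff`). If B ⊨ T, then J(B) embeds
in some A ⊨ S*, and A ⊨ S because S ⊆ S*. So B ≅ I(J(B)) embeds in I(A), which is a model of T*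
because J(I(A)) ≅ A. Conversely T ⊆ T*. Model-completeness means that embeddings of models are
elementary (`isModelComplete_iff`). An embedding M → N of models of T* is conjugate to some I(J(M))
→ I(J(N)). Fullness of I makes this induced by an embedding J(M) → J(N), which is elementary since
S* is model-complete. Translation of formulas carries elementarity back (`Induces.elementary`). -/

namespace Companion

/-! ### Diagrams and model-completeness -/

section Diagram

open FirstOrder.Language

variable {L : FirstOrder.Language.{u, u}}

/-- A structure that satisfies the diagram of `M` is an extension of `M`. -/
theorem exists_embedding_of_models_diagram {M N : Type u} [L.Structure M] [L.Structure N]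
    [L[[M]].Structure N] [(L.lhomWithConstants M).IsExpansionOn N] (h : N ⊨ diagram L M) :
    ∃ f : M ↪[L] N, ∀ m, f m = (L.con m : N) := by
  -- Quantifier-free sentences are closed under negation, so truth in N of those that hold in M
  -- already gives an equivalence. Its converse half yields injectivity and reflection of relations.
  have key : ∀ φ : L[[M]].Sentence, BoundedFormula.IsQF φ → (M ⊨ φ ↔ N ⊨ φ) := fun φ hφ =>
    ⟨fun hM => h.realize_of_mem φ ⟨hφ, hM⟩, fun hN => by_contra fun hM =>
      h.realize_of_mem (Formula.not φ) ⟨hφ.not, (Sentence.realize_not M).2 hM⟩ hN⟩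
  let c : M → L[[M]].Term (Empty ⊕ Fin 0) := fun m => (L.con m).term
  have hcM : ∀ (m : M) (v : Empty ⊕ Fin 0 → M), (c m).realize v = m := fun m v =>
    Term.realize_constants
  have hcN : ∀ (m : M) (v : Empty ⊕ Fin 0 → N), (c m).realize v = (L.con m : N) := fun m v =>
    Term.realize_constants
  refine ⟨⟨⟨fun m => (L.con m : N), fun a b hab => ?_⟩, fun {n} f x => ?_, fun {n} R x => ?_⟩,
    fun m => rfl⟩
  · have := (key ((c a).bdEqual (c b)) (BoundedFormula.IsAtomic.equal _ _).isQF).2 (by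
      simpa [Sentence.Realize, Formula.Realize, hcN] using hab)
    simpa [Sentence.Realize, Formula.Realize, hcM] using this
  · have := (key ((Term.func ((L.lhomWithConstants M).onFunction f) fun i => c (x i)).bdEqual
      (c (Structure.funMap f x))) (BoundedFormula.IsAtomic.equal _ _).isQF).1 (by
        simp only [Sentence.Realize, Formula.Realize, BoundedFormula.realize_bdEqual,
          Term.realize_func, hcM, LHom.map_onFunction])
    simp only [Sentence.Realize, Formula.Realize, BoundedFormula.realize_bdEqual,
      Term.realize_func, hcN, LHom.map_onFunction] at this
    exact this.symm
  · have := key (Relations.boundedFormula ((L.lhomWithConstants M).onRelation R) fun i => c (x i))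
      (BoundedFormula.IsAtomic.rel _ _).isQF
    simp only [Sentence.Realize, Formula.Realize, BoundedFormula.realize_rel, hcN, hcM,
      LHom.map_onRelation] at this
    exact this.symm

/-- An extension of `M` satisfies the diagram of `M`. -/
theorem models_diagram {M N : Type u} [L.Structure M] [L.Structure N] (f : M ↪[L] N) :
    let := constantsOn.structure (α := M) f
    N ⊨ diagram L M := by
  let := constantsOn.structure (α := M) f
  -- Once the constants are interpreted in N by `f`, the same map is an embedding in the expanded
  -- signature, and quantifier-free sentences are invariant under embeddings.
  let g : M ↪[L[[M]]] N :=
    ⟨f.toEmbedding, fun {n} s x => by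
      rcases s with s | s
      · exact f.map_fun s x
      · cases n with
        | zero => rfl
        | succ n => exact isEmptyElim s, fun {n} s x => by
      rcases s with s | s
      · exact f.map_rel s x
      · exact isEmptyElim s⟩
  refine ⟨fun φ hφ => ?_⟩
  have := (hφ.1.realize_embedding (f := g) (v := default) (xs := default)).2 hφ.2
  simpa [Sentence.Realize, Formula.Realize, Unique.eq_default] using this

/-- A theory is model-complete if and only if all embeddings of its models are elementary. -/
theorem isModelComplete_iff {T : L.Theory} :
    IsModelComplete T ↔ ∀ (M N : Mod T) (f : M ↪[L] N) {n : ℕ} (φ : L.Formula (Fin n))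
      (x : Fin n → M), φ.Realize (f ∘ x) ↔ φ.Realize x := by
  constructor
  · intro h M N f n φ x
    let := constantsOn.structure (α := M) f
    have hN : N ⊨ ((L.lhomWithConstants M).onTheory T ∪ diagram L M) :=
      ((LHom.onTheory_model _ _).2 N.is_model).union (models_diagram f)
    have hM : M ⊨ ((L.lhomWithConstants M).onTheory T ∪ diagram L M) :=
      ((LHom.onTheory_model _ _).2 M.is_model).union ⟨fun φ hφ => hφ.2⟩
    have := ((h M).realize_sentence_iff (Formula.equivSentence (φ.relabel x)) N).trans
      ((h M).realize_sentence_iff (Formula.equivSentence (φ.relabel x)) M).symm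
    rw [Formula.realize_equivSentence, Formula.realize_equivSentence, Formula.realize_relabel,
      Formula.realize_relabel] at this
    exact this
  · intro h M
    have hM : M ⊨ ((L.lhomWithConstants M).onTheory T ∪ diagram L M) :=
      ((LHom.onTheory_model _ _).2 M.is_model).union ⟨fun φ hφ => hφ.2⟩
    -- For completeness it is enough that every model N of the union satisfies the same sentences
    -- with parameters as M. N extends M by the diagram, and by hypothesis the extension is
    -- elementary.
    have key : ∀ (N : ((L.lhomWithConstants M).onTheory T ∪ diagram L M).ModelType)
        (φ : L[[M]].Sentence), M ⊨ φ ↔ N ⊨ φ := by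
      intro N φ
      let := (L.lhomWithConstants M).reduct N
      have hN : N ⊨ T := (LHom.onTheory_model (L.lhomWithConstants M) T).1
        (N.is_model.mono Set.subset_union_left)
      obtain ⟨f, hf⟩ := exists_embedding_of_models_diagram (L := L) (M := M) (N := N)
        (N.is_model.mono Set.subset_union_right)
      let F : M ↪ₑ[L] N := ⟨f, fun _ => h M hN.bundled f⟩
      have e : (fun m => (L.con m : N)) = F ∘ fun m => (L.con m : M) :=
        funext fun m => (hf m).symm
      rw [← Formula.realize_equivSentence_symm_con N, e, F.map_formula,
        Formula.realize_equivSentence_symm_con]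
    refine ⟨⟨Theory.ModelType.of _ M⟩, fun φ => ?_⟩
    rw [Theory.models_sentence_iff, Theory.models_sentence_iff]
    by_cases hφ : M ⊨ φ
    · exact Or.inl fun N => (key N φ).1 hφ
    · exact Or.inr fun N => (key N φ.not).1 ((Sentence.realize_not M).2 hφ)

end Diagram

/-! ### Translation of formulas through an interpretation -/

namespace Interpretation

open FirstOrder.Language

variable {L₁ L₂ : FirstOrder.Language.{u, u}} {S : L₁.Theory} {T : L₂.Theory}

/-- A property of families of elements of the domain of `I` is expressed, uniformly in the models
of `S`, by a formula about their coordinates. -/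
def Expressible (I : Interpretation S T) {β : Type*}
    (P : ∀ A : Mod S, (β → I.Dom A) → Prop) : Prop :=
  ∃ ψ : L₁.Formula (β × Fin I.dim), ∀ (A : Mod S) (a : β → I.Dom A),
    ψ.Realize (fun p => (a p.1).1 p.2) ↔ P A a

namespace Expressible

variable {I : Interpretation S T} {β γ : Type*} {P Q : ∀ A : Mod S, (β → I.Dom A) → Prop}

theorem falsum : I.Expressible fun A (_ : β → I.Dom A) => False :=
  ⟨⊥, fun _ _ => by simp [Formula.Realize]⟩

theorem imp (hP : I.Expressible P) (hQ : I.Expressible Q) :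
    I.Expressible fun A a => P A a → Q A a := by
  obtain ⟨ψ, hψ⟩ := hP
  obtain ⟨χ, hχ⟩ := hQ
  exact ⟨ψ.imp χ, fun A a => by rw [Formula.realize_imp, hψ, hχ]⟩

theorem and (hP : I.Expressible P) (hQ : I.Expressible Q) :
    I.Expressible fun A a => P A a ∧ Q A a := by
  obtain ⟨ψ, hψ⟩ := hP
  obtain ⟨χ, hχ⟩ := hQ
  exact ⟨ψ ⊓ χ, fun A a => by rw [Formula.realize_inf, hψ, hχ]⟩

theorem forall_fin {ι : Type*} [Finite ι] {P : ι → ∀ A : Mod S, (β → I.Dom A) → Prop}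
    (hP : ∀ i, I.Expressible (P i)) : I.Expressible fun A a => ∀ i, P i A a := by
  choose ψ hψ using hP
  exact ⟨Formula.iInf ψ, fun A a => by
    rw [Formula.realize_iInf]; exact forall_congr' fun i => hψ i A a⟩

theorem reindex (hP : I.Expressible P) (g : β → γ) :
    I.Expressible fun A (a : γ → I.Dom A) => P A fun b => a (g b) := by
  obtain ⟨ψ, hψ⟩ := hP
  exact ⟨ψ.relabel (Prod.map g id), fun A a => by
    rw [Formula.realize_relabel]; exact hψ A fun b => a (g b)⟩

theorem of_formula {k : ℕ} (ψ : L₁.Formula (Fin k × Fin I.dim)) :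
    I.Expressible fun A (a : Fin k → I.Dom A) => I.Holds ψ a :=
  ⟨ψ, fun _ _ => Iff.rfl⟩

/-- Quantification over finitely many elements of the domain. -/
theorem exists_sumElim [Finite γ] {P : ∀ A : Mod S, (β ⊕ γ → I.Dom A) → Prop}
    (hP : I.Expressible P) :
    I.Expressible fun A a => ∃ c : γ → I.Dom A, P A (Sum.elim a c) := by
  obtain ⟨ψ, hψ⟩ := hP
  -- The quantifier over tuples must be relativized to the domain formula, which is what `δ` does.
  let δ : L₁.Formula ((β × Fin I.dim) ⊕ (γ × Fin I.dim)) :=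
    Formula.iInf fun i : γ => I.dom.relabel fun j => Sum.inr (i, j)
  let ψ' : L₁.Formula ((β × Fin I.dim) ⊕ (γ × Fin I.dim)) :=
    ψ.relabel fun p => p.1.elim (fun b => Sum.inl (b, p.2)) fun c => Sum.inr (c, p.2)
  refine ⟨(δ ⊓ ψ').iExs (γ × Fin I.dim), fun A a => ?_⟩
  have key : ∀ c : γ → I.Dom A,
      ψ'.Realize (Sum.elim (fun p => (a p.1).1 p.2) fun p => (c p.1).1 p.2) ↔
        P A (Sum.elim a c) := fun c => by
    rw [← hψ, Formula.realize_relabel]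
    refine iff_of_eq (congrArg _ (funext fun p => ?_))
    rcases p with ⟨b | c, j⟩ <;> rfl
  simp only [Formula.realize_iExs, Formula.realize_inf]
  constructor
  · rintro ⟨c, hδ, h⟩
    rw [Formula.realize_iInf] at hδ
    exact ⟨fun i => ⟨fun j => c (i, j), by simpa [Function.comp_def] using hδ i⟩, (key _).1 h⟩
  · rintro ⟨c, h⟩
    refine ⟨fun p => (c p.1).1 p.2, ?_, (key c).2 h⟩
    rw [Formula.realize_iInf]
    exact fun i => by simpa [Function.comp_def] using (c i).2

/-- The graph of a term of the interpreted structure. -/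
theorem term (t : L₂.Term β) : I.Expressible fun A (a : β ⊕ Unit → I.Dom A) =>
    t.realize (fun b => I.coord (a (Sum.inl b))) = I.coord (a (Sum.inr ())) := by
  induction t with
  | var b =>
    obtain ⟨ψ, hψ⟩ := (of_formula I.eqv).reindex ![(Sum.inl b : β ⊕ Unit), Sum.inr ()]
    refine ⟨ψ, fun A a => (hψ A a).trans ?_⟩
    refine Iff.trans (iff_of_eq (congrArg _ ?_)) (Scheme.coord_eq_coord (I.admissible A) _ _).symm
    funext i; fin_cases i <;> rfl
  | @func k f ts ih =>
    -- Unnesting: f(t₁, …, tₖ) = y holds when some tuple c of values of the tᵢ satisfies the formula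
    -- for the graph of f at (c, y). The slots `Fin k` hold c and the slot `Unit` holds y.
    have hargs := forall_fin fun i : Fin k =>
      (ih i).reindex (Sum.elim (fun b => Sum.inl (Sum.inl b)) fun _ => Sum.inr i :
        β ⊕ Unit → (β ⊕ Unit) ⊕ Fin k)
    have hgraph := (of_formula (I := I) (I.graph f)).reindex
      (Fin.snoc (α := fun _ => (β ⊕ Unit) ⊕ Fin k) (fun i => Sum.inr i)
        (Sum.inl (Sum.inr ())))
    obtain ⟨ψ, hψ⟩ := (hargs.and hgraph).exists_sumElim
    refine ⟨ψ, fun A a => (hψ A a).trans ?_⟩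
    have hs : ∀ c : Fin k → I.Dom A,
        (fun b => (Sum.elim a c : (β ⊕ Unit) ⊕ Fin k → I.Dom A)
          ((Fin.snoc (α := fun _ => (β ⊕ Unit) ⊕ Fin k) (fun i => Sum.inr i)
            (Sum.inl (Sum.inr ())) : Fin (k + 1) → (β ⊕ Unit) ⊕ Fin k) b)) =
        Fin.snoc (α := fun _ => I.Dom A) c (a (Sum.inr ())) := fun c => by
      funext i
      refine Fin.lastCases ?_ (fun j => ?_) i <;> simp
    simp only [hs, Sum.elim_inl, Sum.elim_inr, Term.realize_func]
    constructor
    · rintro ⟨c, hc, h⟩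
      exact (congrArg _ (funext hc)).trans ((Scheme.funMap_coord (I.admissible A) f c _).2 h)
    · intro h
      choose c hc using fun i : Fin k => I.coord_surjective
        ((ts i).realize fun b => I.coord (a (Sum.inl b)))
      refine ⟨c, fun i => (hc i).symm, (Scheme.funMap_coord (I.admissible A) f c _).1 ?_⟩
      exact (congrArg _ (funext hc)).trans h

/-- The reduction theorem: every formula about the interpreted structure can be translated. -/
theorem boundedFormula {n : ℕ} (φ : L₂.BoundedFormula β n) :
    I.Expressible fun A (a : β ⊕ Fin n → I.Dom A) =>
      φ.Realize (fun b => I.coord (a (Sum.inl b))) fun i => I.coord (a (Sum.inr i)) := by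
  have elim : ∀ {n : ℕ} (A : Mod S) (a : β ⊕ Fin n → I.Dom A),
      (Sum.elim (fun b => I.coord (a (Sum.inl b))) fun i => I.coord (a (Sum.inr i))) =
        fun b => I.coord (a b) := fun A a => by
    funext b; rcases b with b | i <;> rfl
  induction φ with
  | falsum => exact falsum
  | equal t₁ t₂ =>
    -- Only graphs of terms are expressible so far, so t₁ = t₂ is rendered as the existence of a
    -- common value.
    obtain ⟨ψ, hψ⟩ := ((term (I := I) t₁).and (term t₂)).exists_sumElim
    refine ⟨ψ, fun A a => (hψ A a).trans ?_⟩
    simp only [BoundedFormula.Realize, elim, Sum.elim_inl, Sum.elim_inr]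
    constructor
    · rintro ⟨c, h₁, h₂⟩
      exact h₁.trans h₂.symm
    · intro h
      obtain ⟨c, hc⟩ := I.coord_surjective (t₂.realize fun b => I.coord (a b))
      exact ⟨fun _ => c, h.trans hc.symm, hc.symm⟩
  | @rel n k R ts =>
    have hargs := forall_fin fun i : Fin k => (term (I := I) (ts i)).reindex
      (Sum.elim (fun b => Sum.inl b) fun _ => Sum.inr i :
        (β ⊕ Fin n) ⊕ Unit → (β ⊕ Fin n) ⊕ Fin k)
    have hrel := (of_formula (I := I) (I.rel R)).reindex
      (fun i => (Sum.inr i : (β ⊕ Fin n) ⊕ Fin k))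
    obtain ⟨ψ, hψ⟩ := (hargs.and hrel).exists_sumElim
    refine ⟨ψ, fun A a => (hψ A a).trans ?_⟩
    simp only [BoundedFormula.Realize, elim, Sum.elim_inl, Sum.elim_inr]
    constructor
    · rintro ⟨c, hc, h⟩
      exact (congrArg (Structure.RelMap R) (funext hc)).mpr
        ((Scheme.relMap_coord (I.admissible A) R c).2 h)
    · intro h
      choose c hc using fun i : Fin k => I.coord_surjective
        ((ts i).realize fun b => I.coord (a b))
      refine ⟨c, fun i => (hc i).symm, (Scheme.relMap_coord (I.admissible A) R c).1 ?_⟩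
      exact (congrArg (Structure.RelMap R) (funext hc)).mpr h
  | imp _ _ ih₁ ih₂ => exact ih₁.imp ih₂
  | @all n θ ih =>
    -- The universal quantifier is treated as ¬∃¬, with the bound variable moved to the extra slot
    -- `Unit`.
    obtain ⟨ψ, hψ⟩ := ((ih.imp falsum).reindex
      (Sum.elim (fun b => Sum.inl (Sum.inl b)) (Fin.snoc
        (α := fun _ => (β ⊕ Fin n) ⊕ Unit) (fun i => Sum.inl (Sum.inr i)) (Sum.inr ())) :
        β ⊕ Fin (n + 1) → (β ⊕ Fin n) ⊕ Unit)).exists_sumElim.imp falsum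
    refine ⟨ψ, fun A a => (hψ A a).trans ?_⟩
    have hs : ∀ c : Unit → I.Dom A,
        (fun i => I.coord ((Sum.elim a c : (β ⊕ Fin n) ⊕ Unit → I.Dom A)
          ((Fin.snoc (α := fun _ => (β ⊕ Fin n) ⊕ Unit) (fun i => Sum.inl (Sum.inr i))
            (Sum.inr ()) : Fin (n + 1) → (β ⊕ Fin n) ⊕ Unit) i))) =
        Fin.snoc (α := fun _ => I.obj A) (fun i => I.coord (a (Sum.inr i)))
          (I.coord (c ())) := fun c => by
      funext i
      refine Fin.lastCases ?_ (fun j => ?_) i <;> simp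
    simp only [BoundedFormula.realize_all, Sum.elim_inl, Sum.elim_inr, hs]
    constructor
    · intro h x
      obtain ⟨c, rfl⟩ := I.coord_surjective x
      exact by_contra fun hx => h ⟨fun _ => c, hx⟩
    · rintro h ⟨c, hc⟩
      exact hc (h _)

theorem formula (φ : L₂.Formula β) :
    I.Expressible fun A (a : β → I.Dom A) => φ.Realize fun b => I.coord (a b) := by
  obtain ⟨ψ, hψ⟩ := (boundedFormula (I := I) φ).reindex
    (Sum.elim id Fin.elim0 : β ⊕ Fin 0 → β)
  refine ⟨ψ, fun A a => (hψ A a).trans ?_⟩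
  exact iff_of_eq (congrArg _ (Subsingleton.elim _ _))

end Expressible

/-- Every sentence about the interpreted structure can be translated. -/
theorem exists_translation (I : Interpretation S T) (φ : L₂.Sentence) :
    ∃ ψ : L₁.Sentence, ∀ A : Mod S, A ⊨ ψ ↔ I.obj A ⊨ φ := by
  obtain ⟨ψ, hψ⟩ := Expressible.formula (I := I) φ
  refine ⟨ψ.relabel Prod.fst, fun A => ?_⟩
  rw [Sentence.Realize, Formula.realize_relabel, Sentence.Realize]
  refine Iff.trans (iff_of_eq (congrArg _ ?_)) ((hψ A fun e => e.elim).trans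
    (iff_of_eq (congrArg _ ?_)))
  · exact funext fun p => p.1.elim
  · exact Subsingleton.elim _ _

/-- The embedding induced by an elementary embedding is elementary. -/
theorem Induces.elementary {I : Interpretation S T} {A B : Mod S} {h : A ↪ₑ[L₁] B}
    {g : I.obj A → I.obj B} (hg : I.Induces h g) {n : ℕ} (φ : L₂.Formula (Fin n))
    (x : Fin n → I.obj A) : φ.Realize (g ∘ x) ↔ φ.Realize x := by
  -- One translation ψ serves both A and B, so elementarity of `h` for ψ, at chosen coordinates of
  -- x, gives the claim for φ.
  obtain ⟨ψ, hψ⟩ := Expressible.formula (I := I) φ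
  choose a ha using fun i => I.coord_surjective (x i)
  obtain rfl : (fun i => I.coord (a i)) = x := funext ha
  choose hb e using hg
  have e' : (g ∘ fun i => I.coord (a i)) = fun i => I.coord ⟨_, hb (a i)⟩ :=
    funext fun i => e (a i)
  rw [e']
  exact (hψ B fun i => ⟨_, hb (a i)⟩).symm.trans ((h.map_formula ψ _).trans (hψ A a))

/-! ### The pulled-back theory and its models -/

theorem subset_pullbackTheory (J : Interpretation T S) (S' : L₁.Theory) :
    T ⊆ J.pullbackTheory S' :=
  fun _ hφ B _ => B.is_model.realize_of_mem _ hφ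

theorem isDeductivelyClosed_pullbackTheory (J : Interpretation T S) (S' : L₁.Theory) :
    IsDeductivelyClosed (J.pullbackTheory S') := fun _ hφ B hB =>
  haveI : B ⊨ J.pullbackTheory S' := ⟨fun _ hψ => hψ B hB⟩
  hφ.realize_sentence B

/-- The models of the theory of those `B` such that `J(B)` is a model of `S'` are just those `B`. -/
theorem models_pullbackTheory_iff (J : Interpretation T S) (S' : L₁.Theory) (B : Mod T) :
    B ⊨ J.pullbackTheory S' ↔ J.obj B ⊨ S' := by
  refine ⟨fun hB => ⟨fun φ hφ => ?_⟩, fun hB => ⟨fun _ hψ => hψ B hB⟩⟩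
  obtain ⟨ψ, hψ⟩ := J.exists_translation φ
  -- The translation of an axiom of S' holds throughout the class that defines the pulled-back
  -- theory, hence belongs to that theory and holds in B.
  exact (hψ B).1 (hB.realize_of_mem ψ fun C hC => (hψ C).2 (hC.realize_of_mem φ hφ))

end Interpretation

end Companion

/-! ### The model-companion of T -/

open FirstOrder.Language in
theorem theorem2 {L₁ L₂ : FirstOrder.Language.{u, u}} (S Sstar : L₁.Theory) (T : L₂.Theory)
    (I : Companion.Interpretation S T) (J : Companion.Interpretation T S)
    (hIJ : I.IsBiInterpretation J) (hI : I.IsCategoryEquivalence)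
    (hS : Companion.IsModelCompanion S Sstar) (hsub : S ⊆ Sstar) :
    Companion.IsModelCompanion T (J.pullbackTheory Sstar) := by
  obtain ⟨hI, hequiv⟩ := hI
  obtain ⟨⟨_, hA⟩, ⟨_, hB⟩⟩ := hIJ
  choose α _ using hA
  choose β _ using hB
  refine ⟨J.isDeductivelyClosed_pullbackTheory Sstar, fun B => ?_, fun B => ?_, ?_⟩
  · obtain ⟨N, ⟨f⟩⟩ := hS.embed (J.obj B)
    let A : Companion.Mod S := N.subtheoryModel hsub
    let f' : J.obj B ↪[L₁] A := f
    have hA : J.obj (I.obj A) ⊨ Sstar := StrongHomClass.theory_model (α A).symm (T := Sstar)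
    have := (J.models_pullbackTheory_iff Sstar (I.obj A)).2 hA
    exact ⟨Theory.ModelType.of _ (I.obj A),
      ⟨(I.map hI f').comp (β B).symm.toEmbedding⟩⟩
  · exact ⟨B.subtheoryModel (J.subset_pullbackTheory Sstar), ⟨Embedding.refl L₂ B⟩⟩
  · rw [Companion.isModelComplete_iff]
    intro M N f n φ x
    let M' : Companion.Mod T := M.subtheoryModel (J.subset_pullbackTheory Sstar)
    let N' : Companion.Mod T := N.subtheoryModel (J.subset_pullbackTheory Sstar)
    have hM : J.obj M' ⊨ Sstar := (J.models_pullbackTheory_iff Sstar M').1 M.is_model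
    have hN : J.obj N' ⊨ Sstar := (J.models_pullbackTheory_iff Sstar N').1 N.is_model
    let f' : M' ↪[L₂] N' := f
    -- The conjugate of `f` by the isomorphisms `β`; fullness of the functor then makes it induced
    -- by some embedding J(M) → J(N).
    let k : I.obj (J.obj M') ↪[L₂] I.obj (J.obj N') :=
      ((β N').symm.toEmbedding.comp f').comp (β M').toEmbedding
    obtain ⟨g, hg⟩ := (I.functor hI).map_surjective
      (X := J.obj M') (Y := J.obj N') k
    let g₀ : J.obj M' ↪[L₁] J.obj N' := g
    have hg₀ : I.map hI g₀ = k := hg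
    have hk : I.Induces g₀ k := hg₀ ▸ I.map_induces hI g₀
    let g' : J.obj M' ↪ₑ[L₁] J.obj N' :=
      ⟨g₀, fun _ => Companion.isModelComplete_iff.1 hS.modelComplete hM.bundled hN.bundled g₀⟩
    have hk' := Companion.Interpretation.Induces.elementary (h := g') hk φ ((β M').symm ∘ x)
    -- The isomorphism `β M'` cancels against its inverse, so elementarity of `k` at the preimage of
    -- x becomes elementarity of `f` at x, up to the isomorphisms `β`.
    have e : k ∘ (β M').symm ∘ x = (β N').symm ∘ (f' ∘ x) := by
      funext i
      exact congrArg (fun y => (β N').symm (f' y)) ((β M').apply_symm_apply (x i))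
    rw [e] at hk'
    exact (StrongHomClass.realize_formula (β N').symm φ).symm.trans
      (hk'.trans (StrongHomClass.realize_formula (β M').symm φ))
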